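/- Let $K$ be a compact Hausdorff space and let $\mathrm{C}(K)$ be the Banach space of continuous functions $f: K \to \mathbb{C}$ with the supremum norm. We write $f \ge 0$ if $f(x)$ is real and $\ge 0$ for all $x \in K$, and put $\operatorname{opensupp}(f) := \{x \in K : f(x) \neq 0\}$. Let $T: \mathrm{C}(K) \to \mathrm{C}(K)$ be a linear operator which is positive (that is, $Tf \ge 0$ whenever $f \ge 0$) and weakly almost periodic (that is, for each $f \in \mathrm{C}(K)$ the orbit $\{T^n f : n \ge 0\}$ is relatively compact with respect to the weak topology on $\mathrm{C}(K)$). Assume that, for each $0 \le f \in \mathrm{C}(K)$, there exists an integer $n \ge 1$ such that $$\operatorname{opensupp}(T^n f) \supseteq \operatorname{opensupp}(T^{n-1} f).$$ Then $T$ has no eigenvalue of modulus $1$ other than possibly $1$; that is, $\sigma_{\mathrm{pnt}}(T) \cap \mathbb{T} \subseteq \{1\}$, where $\sigma_{\mathrm{pnt}}(T)$ is the set of eigenvalues of $T$ and $\mathbb{T} := \{\lambda \in \mathbb{C} : |\lambda| = 1\}$. -/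

import Mathlib

-- The pointwise order on `C(K, ℂ)` comes from the order on `ℂ` in which
-- `0 ≤ z` means that `z` is real and nonnegative.
open scoped ComplexOrder

/-- A linear operator `T` on a complex normed space is weakly almost periodic if, for each vector
`f`, the orbit `{T ^ n f : n ≥ 0}` is relatively compact in the weak topology. -/
def IsWeaklyAlmostPeriodic {E : Type*} [NormedAddCommGroup E] [NormedSpace ℂ E]
    (T : E →ₗ[ℂ] E) : Prop :=
  ∀ f : E, IsCompact (closure (Set.range fun n : ℕ => toWeakSpace ℂ E ((T ^ n) f)))

/-- A linear operator on `C(K, ℂ)` is positive if it maps functions `f ≥ 0` to functions `≥ 0`. -/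
def IsPositiveOperator {K : Type*} [TopologicalSpace K] (T : C(K, ℂ) →ₗ[ℂ] C(K, ℂ)) : Prop :=
  ∀ f : C(K, ℂ), 0 ≤ f → 0 ≤ T f

/-- The open support `{x ∈ K : f x ≠ 0}` of a continuous function. -/
def openSupp {K : Type*} [TopologicalSpace K] (f : C(K, ℂ)) : Set K :=
  {x | f x ≠ 0}

/-- The point spectrum of a linear operator: the set of its eigenvalues. -/
def pointSpectrum {E : Type*} [AddCommGroup E] [Module ℂ E] (T : E →ₗ[ℂ] E) : Set ℂ :=
  {μ | Module.End.HasEigenvalue T μ}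

open Filter Topology

attribute [local instance] Ultrafilter.addSemigroup

/-! Along an idempotent ultrafilter the powers `T ^ n` and `T ^ (n - 1)` have positive weak limits
`P` and `Q`. Here `P` is a projection fixing all unimodular eigenvectors, and `T * Q = Q * T = P`,
so `T` is invertible on the range of `P` with positive inverse. Hence `T` respects the modulus `P
|e|` there (`map_proj_absMap`).

Let `L` be the zero set of the ideal `{a | P |a| = 0}`. For `e` in the range of `P`, `P |e| = |e|`
on `L`, and `e` is determined by its values on `L`.

If `T f = μ • f` with `μ ≠ 1`, put `c = ‖1 + μ‖ / 2 < 1` and let `h` be twice the positive part of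
`Re f - c P |f|` in this lattice. On `L`, `T ^ n h` is nonzero exactly where `Re (μ ^ n f) > c |f|`.
These sets are disjoint for consecutive `n`, so the support condition forces some `T ^ m h = 0`,
hence `h = 0`; but `h ≠ 0` because `c < 1`. -/

/-- There is an additively idempotent ultrafilter on the positive integers. -/
theorem exists_add_self_eq_ultrafilter_pnat : ∃ U : Ultrafilter ℕ+, U + U = U := by
  obtain ⟨U, hU⟩ := exists_idempotent_of_compact_t2_of_continuous_add_left
    (@Ultrafilter.continuous_add_left ℕ+ _)
  exact ⟨U, hU⟩

/-! ### Weak operator limits of powers. -/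

section WeakLimits

variable {E : Type*} [NormedAddCommGroup E] [NormedSpace ℂ E]

/-- `S` is the limit of the powers `T ^ u i` along `l` in the weak operator topology. -/
def IsWeakPowerLimit {ι : Type*} (T S : E →ₗ[ℂ] E) (u : ι → ℕ) (l : Filter ι) : Prop :=
  ∀ (f : E) (φ : StrongDual ℂ E), Tendsto (fun i => φ ((T ^ u i) f)) l (𝓝 (φ (S f)))

theorem eq_of_forall_strongDual_eq {a b : E} (h : ∀ φ : StrongDual ℂ E, φ a = φ b) : a = b :=
  (SeparatingDual.eq_iff_forall_dual_eq (R := ℂ)).2 h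

theorem IsWeaklyAlmostPeriodic.exists_isWeakPowerLimit {ι : Type*} {T : E →ₗ[ℂ] E}
    (hT : IsWeaklyAlmostPeriodic T) (u : ι → ℕ) (U : Ultrafilter ι) :
    ∃ S : E →ₗ[ℂ] E, IsWeakPowerLimit T S u U := by
  have key : ∀ f : E, ∃ y : E, ∀ φ : StrongDual ℂ E,
      Tendsto (fun i => φ ((T ^ u i) f)) U (𝓝 (φ y)) := by
    intro f
    obtain ⟨y, -, hy⟩ := (hT f).ultrafilter_le_nhds
      (U.map fun i => toWeakSpace ℂ E ((T ^ u i) f)) (by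
        rw [Ultrafilter.coe_map, le_principal_iff, mem_map]
        exact Eventually.of_forall fun i => subset_closure ⟨u i, rfl⟩)
    refine ⟨(toWeakSpace ℂ E).symm y, fun φ => ?_⟩
    have hφ : Continuous fun z : WeakSpace ℂ E => φ ((toWeakSpace ℂ E).symm z) :=
      WeakBilin.eval_continuous (topDualPairing ℂ E).flip φ
    exact (hφ.tendsto y).comp hy
  choose S hS using key
  refine ⟨⟨⟨S, fun a b => ?_⟩, fun c a => ?_⟩, hS⟩
  · refine eq_of_forall_strongDual_eq fun φ => tendsto_nhds_unique (hS (a + b) φ) ?_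
    simpa using (hS a φ).add (hS b φ)
  · refine eq_of_forall_strongDual_eq fun φ => tendsto_nhds_unique (hS (c • a) φ) ?_
    simpa using (hS a φ).const_mul c

theorem IsWeakPowerLimit.mul_right {ι : Type*} {T S S' : E →ₗ[ℂ] E} {u : ι → ℕ} {l : Filter ι}
    [l.NeBot] (hS : IsWeakPowerLimit T S u l)
    (hS' : IsWeakPowerLimit T S' (fun i => u i + 1) l) : S * T = S' := by
  ext f
  refine eq_of_forall_strongDual_eq fun φ => tendsto_nhds_unique (hS (T f) φ) ?_
  simpa [pow_succ] using hS' f φ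

theorem IsWeakPowerLimit.mul_left {ι : Type*} {T S S' : E →ₗ[ℂ] E} (hT : Continuous T)
    {u : ι → ℕ} {l : Filter ι} [l.NeBot] (hS : IsWeakPowerLimit T S u l)
    (hS' : IsWeakPowerLimit T S' (fun i => u i + 1) l) : T * S = S' := by
  ext f
  refine eq_of_forall_strongDual_eq fun φ =>
    tendsto_nhds_unique (hS f (φ.comp ⟨T, hT⟩)) ?_
  simpa [pow_succ'] using hS' f φ

theorem continuous_linearMap_pow {T : E →ₗ[ℂ] E} (hT : Continuous T) (n : ℕ) :
    Continuous ⇑(T ^ n) := by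
  rw [Module.End.coe_pow]
  exact hT.iterate n

/-- Along an idempotent ultrafilter the weak limit of the powers is idempotent. -/
theorem IsWeakPowerLimit.mul_self {T P : E →ₗ[ℂ] E} (hT : Continuous T) {U : Ultrafilter ℕ+}
    (hU : U + U = U) (hP : IsWeakPowerLimit T P (fun n : ℕ+ => (n : ℕ)) U) : P * P = P := by
  ext f
  refine eq_of_forall_strongDual_eq fun φ => ?_
  refine tendsto_nhds_unique (hP (P f) φ) ?_
  -- Closed neighbourhoods survive the inner limit in the iterated limit along `U + U`.
  rw [(closed_nhds_basis (φ (P f))).tendsto_right_iff]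
  rintro W ⟨hW, hWc⟩
  have h : ∀ᶠ k : ℕ+ in ((U + U : Ultrafilter ℕ+) : Filter ℕ+), φ ((T ^ (k : ℕ)) f) ∈ W := by
    rw [hU]
    exact hP f φ hW
  rw [Ultrafilter.eventually_add] at h
  filter_upwards [h] with m hm
  refine hWc.mem_of_tendsto (hP f (φ.comp ⟨T ^ (m : ℕ), continuous_linearMap_pow hT m⟩)) ?_
  filter_upwards [hm] with n hn
  simpa [pow_add] using hn

theorem IsWeakPowerLimit.apply_eq_self {T P : E →ₗ[ℂ] E} {U : Ultrafilter ℕ+}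
    (hPP : P * P = P) (hP : IsWeakPowerLimit T P (fun n : ℕ+ => (n : ℕ)) U) {f : E} {μ : ℂ}
    (hμ : ‖μ‖ = 1) (hf : T f = μ • f) : P f = f := by
  have hpow : ∀ n : ℕ, (T ^ n) f = μ ^ n • f := by
    intro n
    induction n with
    | zero => simp
    | succ n ih => rw [pow_succ', Module.End.mul_apply, ih, map_smul, hf, smul_smul, pow_succ]
  obtain ⟨ζ, hζ, hlim⟩ := (isCompact_sphere (0 : ℂ) 1).ultrafilter_le_nhds
    (U.map fun n : ℕ+ => μ ^ (n : ℕ)) (by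
      rw [Ultrafilter.coe_map, le_principal_iff, mem_map]
      exact Eventually.of_forall fun i => by simp [hμ])
  have hPf : P f = ζ • f := by
    refine eq_of_forall_strongDual_eq fun φ => tendsto_nhds_unique (hP f φ) ?_
    have h : Tendsto (fun n : ℕ+ => μ ^ (n : ℕ)) U (𝓝 ζ) := hlim
    simpa [hpow] using h.mul_const (φ f)
  -- Idempotence of `P` gives `ζ • P f = ζ • f`, and `ζ` cancels.
  have hζ0 : ζ ≠ 0 := by
    rintro rfl
    simp at hζ
  have h2 : ζ • P f = ζ • f := by
    rw [← map_smul, ← hPf]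
    exact LinearMap.congr_fun hPP f
  exact smul_right_injective E hζ0 h2

end WeakLimits

/-! ### Positive operators on `C(K, ℂ)`. -/

section Positive

variable {K : Type*} [TopologicalSpace K]

/-- The pointwise modulus of a complex-valued continuous function. -/
noncomputable def absMap (a : C(K, ℂ)) : C(K, ℂ) := ⟨fun x => (‖a x‖ : ℂ), by fun_prop⟩

/-- The pointwise real part of a complex-valued continuous function. -/
noncomputable def reMap (a : C(K, ℂ)) : C(K, ℂ) := ⟨fun x => ((a x).re : ℂ), by fun_prop⟩

@[simp] theorem absMap_apply (a : C(K, ℂ)) (x : K) : absMap a x = (‖a x‖ : ℂ) := rfl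

@[simp] theorem reMap_apply (a : C(K, ℂ)) (x : K) : reMap a x = ((a x).re : ℂ) := rfl

theorem continuousMap_le_iff {a b : C(K, ℂ)} :
    a ≤ b ↔ ∀ x, (a x).re ≤ (b x).re ∧ (a x).im = (b x).im := Iff.rfl

theorem continuous_absMap [CompactSpace K] : Continuous (absMap : C(K, ℂ) → C(K, ℂ)) :=
  ContinuousMap.continuous_postcomp (⟨fun z : ℂ => (‖z‖ : ℂ), by fun_prop⟩ : C(ℂ, ℂ))

theorem absMap_nonneg (a : C(K, ℂ)) : 0 ≤ absMap a :=
  fun x => by simp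

namespace IsPositiveOperator

variable {S : C(K, ℂ) →ₗ[ℂ] C(K, ℂ)}

theorem monotone (hS : IsPositiveOperator S) : Monotone S := by
  intro a b hab
  have h := hS (b - a) (sub_nonneg.2 hab)
  rwa [map_sub, sub_nonneg] at h

/-- Comparable functions have equal imaginary parts, and `a ≤ |a|` for real `a`. -/
theorem im_apply_eq_zero (hS : IsPositiveOperator S) {a : C(K, ℂ)} (ha : ∀ x, (a x).im = 0)
    (x : K) : (S a x).im = 0 := by
  have hle : a ≤ absMap a := fun x => by
    rw [Complex.le_def]
    exact ⟨by simpa using Complex.re_le_norm (a x), by simpa using ha x⟩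
  have h1 := continuousMap_le_iff.1 (hS.monotone hle) x
  have h2 := continuousMap_le_iff.1 (hS _ (absMap_nonneg a)) x
  rw [h1.2, ← h2.2]
  simp

theorem map_reMap (hS : IsPositiveOperator S) (a : C(K, ℂ)) : S (reMap a) = reMap (S a) := by
  have ha : a = reMap a + Complex.I • reMap (-Complex.I • a) := by
    ext x
    simp [Complex.ext_iff]
  ext x
  have h1 := hS.im_apply_eq_zero (a := reMap a) (by simp) x
  have h2 := hS.im_apply_eq_zero (a := reMap (-Complex.I • a)) (by simp) x
  have h3 : S a x = S (reMap a) x + Complex.I * S (reMap (-Complex.I • a)) x := by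
    conv_lhs => rw [ha]
    simp
  rw [reMap_apply, h3, Complex.ext_iff]
  simp [h1, h2]

theorem norm_apply_le (hS : IsPositiveOperator S) (a : C(K, ℂ)) (x : K) :
    ‖S a x‖ ≤ (S (absMap a) x).re := by
  -- Rotate so that `S a x` becomes its modulus, then compare real parts.
  obtain ⟨μ, hμ, h⟩ : ∃ μ : ℂ, ‖μ‖ = 1 ∧ μ * S a x = ‖S a x‖ := by
    rcases eq_or_ne (S a x) 0 with h0 | h0
    · exact ⟨1, by simp, by simp [h0]⟩
    · have h0' : (‖S a x‖ : ℂ) ≠ 0 := by simpa using h0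
      exact ⟨‖S a x‖ / S a x, by simp [h0], div_mul_cancel₀ _ h0⟩
  have hle : reMap (μ • a) ≤ absMap a := fun y => by
    have := Complex.re_le_norm (μ * a y)
    rw [norm_mul, hμ, one_mul] at this
    rw [Complex.le_def]
    exact ⟨by simpa using this, by simp⟩
  have h1 := (continuousMap_le_iff.1 (hS.monotone hle) x).1
  rw [hS.map_reMap, reMap_apply, map_smul, ContinuousMap.smul_apply, smul_eq_mul, h] at h1
  simpa using h1

theorem absMap_apply_le (hS : IsPositiveOperator S) (a : C(K, ℂ)) :
    absMap (S a) ≤ S (absMap a) := fun x => by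
  have h2 := continuousMap_le_iff.1 (hS _ (absMap_nonneg a)) x
  rw [Complex.le_def]
  exact ⟨by simpa using hS.norm_apply_le a x, by simpa using h2.2⟩

theorem continuous [CompactSpace K] (hS : IsPositiveOperator S) : Continuous S := by
  refine AddMonoidHomClass.continuous_of_bound S ‖S 1‖ fun a => ?_
  rw [ContinuousMap.norm_le _ (by positivity)]
  intro x
  have hle : absMap a ≤ (‖a‖ : ℂ) • (1 : C(K, ℂ)) := fun y => by
    simpa using a.norm_coe_le_norm y
  have h1 := (continuousMap_le_iff.1 (hS.monotone hle) x).1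
  have h2 := (Complex.re_le_norm (S 1 x)).trans ((S 1).norm_coe_le_norm x)
  rw [map_smul, ContinuousMap.smul_apply, smul_eq_mul, Complex.re_ofReal_mul] at h1
  nlinarith [hS.norm_apply_le a x, norm_nonneg a]

theorem pow (hS : IsPositiveOperator S) (n : ℕ) : IsPositiveOperator (S ^ n) := by
  induction n with
  | zero => intro f hf; simpa using hf
  | succ n ih => intro f hf; rw [pow_succ']; exact hS _ (ih f hf)

/-- Weak limits of powers of a positive operator are positive. -/
theorem of_isWeakPowerLimit [CompactSpace K] {ι : Type*} {T : C(K, ℂ) →ₗ[ℂ] C(K, ℂ)}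
    (hT : IsPositiveOperator T) {u : ι → ℕ} {l : Filter ι} [l.NeBot]
    (h : IsWeakPowerLimit T S u l) : IsPositiveOperator S := by
  intro f hf x
  refine ge_of_tendsto (h f (ContinuousMap.evalCLM ℂ x)) (Eventually.of_forall fun i => ?_)
  exact hT.pow (u i) f hf x

/-- The closed ideal on which a positive operator vanishes absolutely. -/
def absKernel [CompactSpace K] (hS : IsPositiveOperator S) : Ideal C(K, ℂ) where
  carrier := {a | S (absMap a) = 0}
  zero_mem' := by
    have : absMap (0 : C(K, ℂ)) = 0 := by ext; simp
    simp [this]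
  add_mem' := by
    intro a b ha hb
    refine le_antisymm ?_ (hS _ (absMap_nonneg _))
    have hle : absMap (a + b) ≤ absMap a + absMap b := fun x => by
      simpa [← Complex.ofReal_add] using norm_add_le (a x) (b x)
    have h := hS.monotone hle
    rw [map_add] at h
    simpa [show S (absMap a) = 0 from ha, show S (absMap b) = 0 from hb] using h
  smul_mem' := by
    intro b a ha
    refine le_antisymm ?_ (hS _ (absMap_nonneg _))
    have hle : absMap (b * a) ≤ (‖b‖ : ℂ) • absMap a := fun x => by
      have := mul_le_mul_of_nonneg_right (b.norm_coe_le_norm x) (norm_nonneg (a x))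
      simpa [← Complex.ofReal_mul] using this
    have h := hS.monotone hle
    rw [map_smul, show S (absMap a) = 0 from ha, smul_zero] at h
    exact h

theorem mem_absKernel [CompactSpace K] (hS : IsPositiveOperator S) {a : C(K, ℂ)} :
    a ∈ hS.absKernel ↔ S (absMap a) = 0 := Iff.rfl

/-- A closed ideal of `C(K, ℂ)` consists of all functions vanishing on its zero set. -/
theorem mem_absKernel_iff_forall [CompactSpace K] [T2Space K] (hS : IsPositiveOperator S)
    {a : C(K, ℂ)} :
    a ∈ hS.absKernel ↔ ∀ x ∉ ContinuousMap.setOfIdeal hS.absKernel, a x = 0 := by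
  have hcl : IsClosed (hS.absKernel : Set C(K, ℂ)) :=
    isClosed_eq (hS.continuous.comp continuous_absMap) continuous_const
  conv_lhs => rw [← ContinuousMap.idealOfSet_ofIdeal_isClosed hcl]
  rw [ContinuousMap.mem_idealOfSet]
  rfl

end IsPositiveOperator

end Positive

/-! ### The lattice structure on the range of `P`. -/

section Reversible

variable {K : Type*} [TopologicalSpace K] {T P Q : C(K, ℂ) →ₗ[ℂ] C(K, ℂ)}

/-- On the range of a positive projection `P`, an operator `T` commuting with `P` and possessing a
positive inverse `Q` there is a homomorphism for the lattice structure with modulus `P |e|`. -/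
theorem map_proj_absMap (hT : IsPositiveOperator T) (hP : IsPositiveOperator P)
    (hQ : IsPositiveOperator Q) (hPP : P * P = P) (hTP : P * T = T * P) (hTQ : T * Q = P)
    (hQT : Q * T = P) {e : C(K, ℂ)} (he : P e = e) :
    T (P (absMap e)) = P (absMap (T e)) := by
  have hTP' : ∀ a, P (T a) = T (P a) := LinearMap.congr_fun hTP
  have hTQ' : ∀ a, T (Q a) = P a := LinearMap.congr_fun hTQ
  have hQT' : ∀ a, Q (T a) = P a := LinearMap.congr_fun hQT
  have hPP' : ∀ a, P (P a) = P a := LinearMap.congr_fun hPP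
  refine le_antisymm ?_ ?_
  -- Since `Q (T e) = e`, this is `T P` applied to `|e| ≤ Q |T e|`.
  · have h := hT.monotone (hP.monotone (hQ.absMap_apply_le (T e)))
    rwa [hQT', he, ← hTP' (Q _), hTQ', hPP'] at h
  · rw [← hTP']
    exact hP.monotone (hT.absMap_apply_le e)

theorem proj_pow_apply (hTP : P * T = T * P) {e : C(K, ℂ)} (he : P e = e) (n : ℕ) :
    P ((T ^ n) e) = (T ^ n) e := by
  have h : P * T ^ n = T ^ n * P := (Commute.pow_right (show Commute P T from hTP) n).eq
  have h' := LinearMap.congr_fun h e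
  rwa [Module.End.mul_apply, Module.End.mul_apply, he] at h'

theorem pow_map_proj_absMap (hT : IsPositiveOperator T) (hP : IsPositiveOperator P)
    (hQ : IsPositiveOperator Q) (hPP : P * P = P) (hTP : P * T = T * P) (hTQ : T * Q = P)
    (hQT : Q * T = P) {e : C(K, ℂ)} (he : P e = e) (n : ℕ) :
    (T ^ n) (P (absMap e)) = P (absMap ((T ^ n) e)) := by
  induction n with
  | zero => simp
  | succ n ih =>
    rw [pow_succ', Module.End.mul_apply, ih,
      map_proj_absMap hT hP hQ hPP hTP hTQ hQT (proj_pow_apply hTP he n), Module.End.mul_apply]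

theorem eq_zero_of_pow_apply_eq_zero (hTP : P * T = T * P) (hQT : Q * T = P) {e : C(K, ℂ)}
    (he : P e = e) {n : ℕ} (h : (T ^ n) e = 0) : e = 0 := by
  induction n with
  | zero => simpa using h
  | succ n ih =>
    refine ih ?_
    rw [← proj_pow_apply hTP he n, ← hQT, Module.End.mul_apply, ← Module.End.mul_apply T,
      ← pow_succ', h, map_zero]

variable [CompactSpace K]

/-- As `|e| = |P e| ≤ P |e|`, the difference is nonnegative and killed by `P`, so it lies in the
ideal. -/
theorem proj_absMap_apply (hP : IsPositiveOperator P) (hPP : P * P = P) {e : C(K, ℂ)}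
    (he : P e = e) {x : K} (hx : x ∉ ContinuousMap.setOfIdeal hP.absKernel) :
    P (absMap e) x = ‖e x‖ := by
  have hle : absMap e ≤ P (absMap e) := by
    simpa [he] using hP.absMap_apply_le e
  have habs : absMap (P (absMap e) - absMap e) = P (absMap e) - absMap e := by
    ext y
    exact (RCLike.norm_of_nonneg' (sub_nonneg.2 (hle y)))
  have hmem : P (absMap e) - absMap e ∈ hP.absKernel := by
    rw [hP.mem_absKernel, habs, map_sub, sub_eq_zero]
    exact LinearMap.congr_fun hPP _
  simpa [sub_eq_zero] using ContinuousMap.notMem_setOfIdeal.1 hx hmem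

variable [T2Space K]

theorem eq_zero_of_forall_notMem (hP : IsPositiveOperator P) {e : C(K, ℂ)} (he : P e = e)
    (h : ∀ x ∉ ContinuousMap.setOfIdeal hP.absKernel, e x = 0) : e = 0 := by
  have h0 := hP.mem_absKernel.1 (hP.mem_absKernel_iff_forall.2 h)
  have hle := hP.absMap_apply_le e
  rw [he, h0] at hle
  ext x
  simpa using congrArg (· x) (le_antisymm hle (absMap_nonneg e))

end Reversible

/-! ### Disjoint supports and the conclusion. -/

theorem re_add_re_mul_le (μ z : ℂ) : z.re + (μ * z).re ≤ ‖1 + μ‖ * ‖z‖ := by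
  rw [← Complex.add_re, ← norm_mul, add_mul, one_mul]
  exact Complex.re_le_norm _

theorem norm_one_add_lt_two {μ : ℂ} (hμ : ‖μ‖ = 1) (h1 : μ ≠ 1) : ‖1 + μ‖ < 2 := by
  have h := norm_add_lt_of_not_sameRay (x := (1 : ℂ)) (y := μ) (by
    rw [sameRay_iff_of_norm_eq (by simp [hμ])]
    exact h1.symm)
  rw [norm_one, hμ] at h
  linarith

theorem norm_ofReal_add_ofReal_ne_zero {r : ℝ} : ((‖(r : ℂ)‖ : ℝ) : ℂ) + r ≠ 0 ↔ 0 < r := by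
  rw [← Complex.ofReal_add, Complex.ofReal_ne_zero, Complex.norm_real, Real.norm_eq_abs]
  rcases le_or_gt r 0 with h | h
  · simp [abs_of_nonpos h, h.not_gt]
  · simp only [abs_of_pos h, h, iff_true]
    positivity

/-- If the open supports do not move away, then an eigenvector for a unimodular eigenvalue in
the reversible part of `T` belongs to the eigenvalue `1`. -/
theorem eigenvalue_eq_one_of_proj {K : Type*} [TopologicalSpace K] [CompactSpace K] [T2Space K]
    {T P Q : C(K, ℂ) →ₗ[ℂ] C(K, ℂ)} (hT : IsPositiveOperator T) (hP : IsPositiveOperator P)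
    (hQ : IsPositiveOperator Q) (hPP : P * P = P) (hTP : P * T = T * P) (hTQ : T * Q = P)
    (hQT : Q * T = P)
    (hsupp : ∀ f : C(K, ℂ), 0 ≤ f →
      ∃ n : ℕ, 1 ≤ n ∧ openSupp ((T ^ (n - 1)) f) ⊆ openSupp ((T ^ n) f))
    {μ : ℂ} (hμ : ‖μ‖ = 1) {f : C(K, ℂ)} (hf : T f = μ • f) (hPf : P f = f) (hf0 : f ≠ 0) :
    μ = 1 := by
  by_contra h1
  obtain ⟨x₀, hx₀, hfx₀⟩ : ∃ x ∉ ContinuousMap.setOfIdeal hP.absKernel, f x ≠ 0 := by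
    by_contra! h
    exact hf0 (eq_zero_of_forall_notMem hP hPf h)
  wlog hone : f x₀ = 1 generalizing f
  · refine this (f := (f x₀)⁻¹ • f) ?_ ?_ ?_ ?_ ?_
    · rw [map_smul, hf, smul_comm]
    · rw [map_smul, hPf]
    · exact smul_ne_zero (inv_ne_zero hfx₀) hf0
    · simp [hfx₀]
    · simp [hfx₀]
  have hpow : ∀ n : ℕ, (T ^ n) f = μ ^ n • f := by
    intro n
    induction n with
    | zero => simp
    | succ n ih => rw [pow_succ', Module.End.mul_apply, ih, map_smul, hf, smul_smul, pow_succ]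
  set c : ℝ := ‖1 + μ‖ / 2 with hc
  have hc1 : c < 1 := by
    have := norm_one_add_lt_two hμ h1
    rw [hc]
    linarith
  set e : C(K, ℂ) := reMap f - (c : ℂ) • P (absMap f) with he
  have hPe : P e = e := by
    rw [he, map_sub, map_smul, hP.map_reMap, hPf, ← Module.End.mul_apply, hPP]
  have hTe : ∀ n, (T ^ n) e = reMap (μ ^ n • f) - (c : ℂ) • P (absMap f) := by
    intro n
    have habs : absMap (μ ^ n • f) = absMap f := by
      ext x
      simp [hμ]
    rw [he, map_sub, map_smul, (hT.pow n).map_reMap, hpow,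
      pow_map_proj_absMap hT hP hQ hPP hTP hTQ hQT hPf, hpow, habs]
  set h : C(K, ℂ) := P (absMap e) + e with hh
  have hPh : P h = h := by
    rw [hh, map_add, hPe, ← Module.End.mul_apply, hPP]
  have hTex : ∀ n, ∀ x ∉ ContinuousMap.setOfIdeal hP.absKernel,
      (T ^ n) e x = (((μ ^ n * f x).re - c * ‖f x‖ : ℝ) : ℂ) := by
    intro n x hx
    rw [hTe]
    simp [proj_absMap_apply hP hPP hPf hx]
  have hThx : ∀ n, ∀ x ∉ ContinuousMap.setOfIdeal hP.absKernel,
      ((T ^ n) h x ≠ 0 ↔ 0 < (μ ^ n * f x).re - c * ‖f x‖) := by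
    intro n x hx
    rw [hh, map_add, pow_map_proj_absMap hT hP hQ hPP hTP hTQ hQT hPe, ContinuousMap.add_apply,
      proj_absMap_apply hP hPP (proj_pow_apply hTP hPe n) hx, hTex n x hx,
      norm_ofReal_add_ofReal_ne_zero]
  have hh0 : 0 ≤ h := by
    have hle := hP.absMap_apply_le e
    rw [hPe] at hle
    intro x
    have him : (e x).im = 0 := by
      have := hP.im_apply_eq_zero (a := absMap f) (by simp) x
      simp [he, this]
    have h2 := (continuousMap_le_iff.1 hle x)
    have h3 := neg_le_of_abs_le (Complex.abs_re_le_norm (e x))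
    simp only [absMap_apply, Complex.ofReal_re, Complex.ofReal_im] at h2
    change 0 ≤ h x
    rw [Complex.le_def, hh]
    simp only [ContinuousMap.add_apply, Complex.add_re, Complex.add_im, Complex.zero_re,
      Complex.zero_im, him, ← h2.2, add_zero, and_true]
    linarith [h2.1]
  obtain ⟨n, hn, hsub⟩ := hsupp h hh0
  obtain ⟨m, rfl⟩ : ∃ m, n = m + 1 := ⟨n - 1, by omega⟩
  rw [Nat.add_sub_cancel] at hsub
  have hTm : (T ^ m) h = 0 := by
    refine eq_zero_of_forall_notMem hP (proj_pow_apply hTP hPh m) fun x hx => ?_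
    by_contra hne
    have h2 := (hThx m x hx).1 hne
    have h3 := (hThx (m + 1) x hx).1 (hsub hne)
    -- Both strict inequalities would sum to more than `2 * c * ‖f x‖`.
    have h4 := re_add_re_mul_le μ (μ ^ m * f x)
    rw [← mul_assoc, ← pow_succ', norm_mul, norm_pow, hμ, one_pow, one_mul] at h4
    have h5 : ‖1 + μ‖ = 2 * c := by rw [hc]; ring
    rw [h5] at h4
    linarith
  have hzero : h = 0 := eq_zero_of_pow_apply_eq_zero hTP hQT hPh hTm
  refine (hThx 0 x₀ hx₀).2 ?_ ?_
  · simpa [hone] using hc1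
  · simp [hzero]

theorem theorem2p7 {K : Type*} [TopologicalSpace K] [CompactSpace K] [T2Space K]
    (T : C(K, ℂ) →ₗ[ℂ] C(K, ℂ))
    (hpos : IsPositiveOperator T)
    (hwap : IsWeaklyAlmostPeriodic T)
    (hsupp : ∀ f : C(K, ℂ), 0 ≤ f →
      ∃ n : ℕ, 1 ≤ n ∧ openSupp ((T ^ (n - 1)) f) ⊆ openSupp ((T ^ n) f)) :
    pointSpectrum T ∩ {μ : ℂ | ‖μ‖ = 1} ⊆ {1} := by
  rintro μ ⟨hμ, hnorm⟩
  obtain ⟨f, hf⟩ := Module.End.HasEigenvalue.exists_hasEigenvector hμ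
  obtain ⟨U, hU⟩ := exists_add_self_eq_ultrafilter_pnat
  obtain ⟨P, hP⟩ := hwap.exists_isWeakPowerLimit (fun n : ℕ+ => (n : ℕ)) U
  -- Truncated subtraction is harmless because the index is positive.
  obtain ⟨Q, hQ⟩ := hwap.exists_isWeakPowerLimit (fun n : ℕ+ => (n : ℕ) - 1) U
  obtain ⟨R, hR⟩ := hwap.exists_isWeakPowerLimit (fun n : ℕ+ => (n : ℕ) + 1) U
  have hQP : IsWeakPowerLimit T P (fun n : ℕ+ => (n : ℕ) - 1 + 1) U := by
    have h : (fun n : ℕ+ => (n : ℕ) - 1 + 1) = fun n : ℕ+ => (n : ℕ) :=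
      funext fun n => Nat.sub_add_cancel n.pos
    rwa [h]
  have hPP := hP.mul_self hpos.continuous hU
  exact eigenvalue_eq_one_of_proj hpos (hpos.of_isWeakPowerLimit hP)
    (hpos.of_isWeakPowerLimit hQ) hPP
    ((hP.mul_right hR).trans (hP.mul_left hpos.continuous hR).symm)
    (hQ.mul_left hpos.continuous hQP) (hQ.mul_right hQP) hsupp hnorm hf.apply_eq_smul
    (hP.apply_eq_self hPP hnorm hf.apply_eq_smul) hf.2
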